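/- Let $a_0,a_1,d_0,d_1,k>0$, let \[ Y(s)=k\,\frac{a_0s^2+a_1s+1}{s(d_0s^2+d_1s+1)} \] be positive-real (that is, $Y$ has no pole in $\operatorname{Re}s>0$ and $\operatorname{Re}Y(s)\ge 0$ there), and put $R_k=(a_0-d_0)^2-(a_0d_1-a_1d_0)(a_1-d_1)$. Assume $R_k\neq 0$. Then $Y$ is the driving-point admittance of a two-terminal network consisting of finitely many resistors and inductors with positive values (an RL network) if and only if $R_k<0$. Moreover, if $R_k<0$, then $a_1^2-4a_0>0$ and $d_1^2-4d_0>0$, and with \[ A,C=\tfrac12\Bigl(a_1\pm\sqrt{a_1^2-4a_0}\Bigr),\qquad B,D=\tfrac12\Bigl(d_1\pm\sqrt{d_1^2-4d_0}\Bigr) \] (the sign $+$ for $A$ and $B$, the sign $-$ for $C$ and $D$) one has $A>B>C>D>0$ and \[ Y(s)=k\,\frac{(As+1)(Cs+1)}{s(Bs+1)(Ds+1)}, \] and $Y$ is the admittance of the parallel connection of three branches: an inductor $L_1$; an inductor $L_2$ in series with a resistor $R_1$; an inductor $L_3$ in series with a resistor $R_2$, with the positive element values \[ L_1=\frac1k,\quad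 L_2=\frac{B(B-D)}{k(A-B)(B-C)},\quad L_3=\frac{D(B-D)}{k(A-D)(C-D)},\quad R_1=\frac{B-D}{k(A-B)(B-C)},\quad R_2=\frac{B-D}{k(A-D)(C-D)}. \] -/

import Mathlib

/-- A two-terminal circuit element of resistor or inductor type, with its value. -/
inductive RLElement where
  | resistor (R : ℝ) : RLElement
  | inductor (L : ℝ) : RLElement

namespace RLElement

/-- The value (resistance or inductance) of an element. -/
def value : RLElement → ℝ
  | resistor R => R
  | inductor L => L

/-- The impedance as a real rational function of the complex frequency `s`, written `X`:
`R` for a resistor and `L s` for an inductor. -/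
noncomputable def impedance : RLElement → RatFunc ℝ
  | resistor R => RatFunc.C R
  | inductor L => RatFunc.C L * RatFunc.X

end RLElement

/-- A two-terminal RL network: a finite directed multigraph (the direction of an edge is only the
reference direction of its current), carrying a resistor or an inductor on every edge, with two
distinct external terminals. The topology is arbitrary, not only series-parallel. -/
structure RLNetwork where
  /-- number of nodes -/
  nodes : ℕ
  /-- number of elements -/
  elements : ℕ
  tail : Fin elements → Fin nodes
  head : Fin elements → Fin nodes
  elt : Fin elements → RLElement
  terminal : Fin nodes
  terminal' : Fin nodes
  terminal_ne : terminal ≠ terminal'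

namespace RLNetwork

/-- All the element values are positive (and finite, being real numbers). -/
def ElementsPositive (N : RLNetwork) : Prop :=
  ∀ e, 0 < (N.elt e).value

/-- The total current leaving the node `x` through the elements of the network. -/
noncomputable def outflow (N : RLNetwork) (i : Fin N.elements → RatFunc ℝ) (x : Fin N.nodes) :
    RatFunc ℝ :=
  (∑ e, if N.tail e = x then i e else 0) - ∑ e, if N.head e = x then i e else 0

/-- The port voltage `V` and the port current `I` (Laplace transforms) are compatible with the
network: there are node potentials and element currents that satisfy the element laws and
Kirchhoff's laws, with `I` entering at one terminal and leaving at the other. -/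
def PortCompatible (N : RLNetwork) (V I : RatFunc ℝ) : Prop :=
  ∃ (v : Fin N.nodes → RatFunc ℝ) (i : Fin N.elements → RatFunc ℝ),
    (∀ e, v (N.tail e) - v (N.head e) = (N.elt e).impedance * i e) ∧
    (∀ x, N.outflow i x = if x = N.terminal then I else if x = N.terminal' then -I else 0) ∧
    v N.terminal - v N.terminal' = V

/-- `Y` is the driving-point admittance of the network: the port law is exactly `I = Y V`. -/
def HasAdmittance (N : RLNetwork) (Y : RatFunc ℝ) : Prop :=
  ∀ V I : RatFunc ℝ, N.PortCompatible V I ↔ I = Y * V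

/-- The five-element network in which three branches are connected in parallel between the two
terminals (nodes `0` and `1`): the inductor `L₁`, the series connection of `L₂` and `R₁` (through
node `2`), and the series connection of `L₃` and `R₂` (through node `3`). -/
def threeBranch (L₁ L₂ L₃ R₁ R₂ : ℝ) : RLNetwork where
  nodes := 4
  elements := 5
  tail := ![0, 0, 2, 0, 3]
  head := ![1, 2, 1, 3, 1]
  elt := ![.inductor L₁, .inductor L₂, .resistor R₁, .inductor L₃, .resistor R₂]
  terminal := 0
  terminal' := 1
  terminal_ne := by decide

end RLNetwork

/-- `Y` is realizable as an RL network: it is the admittance of some two-terminal network of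
finitely many resistors and inductors with positive values. -/
def IsRLRealizable (Y : RatFunc ℝ) : Prop :=
  ∃ N : RLNetwork, N.ElementsPositive ∧ N.HasAdmittance Y

/-- A real rational function is positive-real if it has no pole in the open right half-plane and
its real part is nonnegative there. (It is real on the real axis since its coefficients are.) -/
def IsPositiveReal (Y : RatFunc ℝ) : Prop :=
  ∀ s : ℂ, 0 < s.re →
    Y.denom.eval₂ (algebraMap ℝ ℂ) s ≠ 0 ∧ 0 ≤ (Y.eval (algebraMap ℝ ℂ) s).re

/-- The admittance `Y(s) = k (a₀ s² + a₁ s + 1) / (s (d₀ s² + d₁ s + 1))`. -/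
noncomputable def admittance (a₀ a₁ d₀ d₁ k : ℝ) : RatFunc ℝ :=
  RatFunc.C k * (RatFunc.C a₀ * RatFunc.X ^ 2 + RatFunc.C a₁ * RatFunc.X + 1) /
    (RatFunc.X * (RatFunc.C d₀ * RatFunc.X ^ 2 + RatFunc.C d₁ * RatFunc.X + 1))

/-- `R_k = (a₀ - d₀)² - (a₀ d₁ - a₁ d₀)(a₁ - d₁)`. -/
def Rk (a₀ a₁ d₀ d₁ : ℝ) : ℝ :=
  (a₀ - d₀) ^ 2 - (a₀ * d₁ - a₁ * d₀) * (a₁ - d₁)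

/-! Necessity is an energy argument. By Tellegen's theorem, at port voltage 1 the current satisfies
`Y = ∑ conj(Z_e) |i_e|²`, and `Im (s conj(Z_e))` is `R Im s` for a resistor and 0 for an inductor,
so `Im (s Y) ≥ 0` in the upper half-plane. For the given `Y` this says, up to a positive factor,
that `(a₀d₁ - a₁d₀)|s|² + 2(a₀ - d₀) Re s + (a₁ - d₁) ≥ 0`. As `Im s → 0` it becomes a real
quadratic in `Re s` that is nonnegative everywhere; its discriminant is `4 R_k`, so `R_k ≤ 0`.

Sufficiency rests on `R_k = (A-B)(A-D)(C-B)(C-D)`. A negative value forces both quadratics to split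
over the reals (`discrims_pos_of_Rk_neg`) and the pairs `A, C` and `B, D` to interlace.
Positive-realness enters only through `d₁ ≤ a₁`, that is `B + D ≤ A + C`, which selects the order `A
> B > C > D`. The partial fractions of `Y` then have positive coefficients, and each term is the
admittance of one branch. -/

/-! ### Passivity of RL networks -/

open Polynomial in
/-- The impedance of an element as a polynomial. -/
noncomputable def RLElement.polyImpedance : RLElement → ℝ[X]
  | .resistor R => Polynomial.C R
  | .inductor L => Polynomial.C L * Polynomial.X

lemma RLElement.algebraMap_polyImpedance (z : RLElement) :
    algebraMap (Polynomial ℝ) (RatFunc ℝ) z.polyImpedance = z.impedance := by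
  cases z <;> simp [RLElement.polyImpedance, RLElement.impedance]

/-- For an element of positive value, `Im (s * conj (Z s)) ≥ 0` when `Im s ≥ 0`. -/
lemma RLElement.im_mul_conj_polyImpedance_nonneg (z : RLElement) (hz : 0 < z.value) {s : ℂ}
    (hs : 0 ≤ s.im) :
    0 ≤ (s * (starRingEnd ℂ) (Polynomial.aeval s z.polyImpedance)).im := by
  cases z with
  | resistor R =>
    simp only [RLElement.value] at hz
    simp [RLElement.polyImpedance]
    positivity
  | inductor L =>
    simp [RLElement.polyImpedance]
    apply le_of_eq
    ring

/-- Tellegen's theorem for a directed multigraph. -/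
lemma sum_mul_outflow {n m : ℕ} {K : Type*} [CommRing K] (t h : Fin m → Fin n)
    (w : Fin n → K) (i : Fin m → K) :
    ∑ x, w x * ((∑ e, if t e = x then i e else 0) - ∑ e, if h e = x then i e else 0) =
      ∑ e, (w (t e) - w (h e)) * i e := by
  have key : ∀ f : Fin m → Fin n,
      ∑ x, w x * (∑ e, if f e = x then i e else 0) = ∑ e, w (f e) * i e := by
    intro f
    simp_rw [Finset.mul_sum]
    rw [Finset.sum_comm]
    simp
  simp_rw [mul_sub, Finset.sum_sub_distrib, key, sub_mul, Finset.sum_sub_distrib]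

namespace RLNetwork

/-- A solution of the network equations over `ℝ(X)` can be scaled to a polynomial one. -/
lemma PortCompatible.exists_polynomial {N : RLNetwork} {Y : RatFunc ℝ}
    (h : N.PortCompatible 1 Y) :
    ∃ (b J : Polynomial ℝ) (v : Fin N.nodes → Polynomial ℝ) (i : Fin N.elements → Polynomial ℝ),
      b ≠ 0 ∧ algebraMap _ (RatFunc ℝ) J = algebraMap _ (RatFunc ℝ) b * Y ∧
      (∀ e, v (N.tail e) - v (N.head e) = (N.elt e).polyImpedance * i e) ∧
      (∀ x, (∑ e, if N.tail e = x then i e else 0) - (∑ e, if N.head e = x then i e else 0) =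
        if x = N.terminal then J else if x = N.terminal' then -J else 0) ∧
      v N.terminal - v N.terminal' = b := by
  obtain ⟨v, i, h1, h2, h3⟩ := h
  -- A single common denominator `b` serves all potentials, all currents and `Y`. The polynomial
  -- solution can be evaluated at every complex `s`, and its port voltage is `b` because the
  -- original one is 1.
  obtain ⟨b, hb⟩ := IsLocalization.exist_integer_multiples_of_finite
    (nonZeroDivisors (Polynomial ℝ)) (Sum.elim (Sum.elim v i) (fun _ : Unit => Y))
  choose f hf using hb
  have hv : ∀ x, algebraMap _ (RatFunc ℝ) (f (.inl (.inl x))) =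
      algebraMap _ (RatFunc ℝ) (b : Polynomial ℝ) * v x := fun x => by
    rw [hf]; simp [Algebra.smul_def]
  have hi : ∀ e, algebraMap _ (RatFunc ℝ) (f (.inl (.inr e))) =
      algebraMap _ (RatFunc ℝ) (b : Polynomial ℝ) * i e := fun e => by
    rw [hf]; simp [Algebra.smul_def]
  have hJ : algebraMap _ (RatFunc ℝ) (f (.inr ())) =
      algebraMap _ (RatFunc ℝ) (b : Polynomial ℝ) * Y := by
    rw [hf]; simp [Algebra.smul_def]
  have inj := RatFunc.algebraMap_injective ℝ
  refine ⟨b, f (.inr ()), fun x => f (.inl (.inl x)), fun e => f (.inl (.inr e)),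
    nonZeroDivisors.ne_zero b.2, hJ, fun e => inj ?_, fun x => inj ?_, inj ?_⟩
  · rw [map_sub, map_mul, hv, hv, hi, RLElement.algebraMap_polyImpedance, ← mul_sub, h1]
    ring
  · have := congrArg (algebraMap _ (RatFunc ℝ) (b : Polynomial ℝ) * ·) (h2 x)
    simp only [outflow, mul_sub, Finset.mul_sum, mul_ite, mul_zero, mul_neg] at this
    simp only [map_sub, map_sum, apply_ite (algebraMap (Polynomial ℝ) (RatFunc ℝ)), map_zero,
      map_neg, hi, hJ]
    exact this
  · rw [map_sub, hv, hv, ← mul_sub, h3, mul_one]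

/-- For an RL network, `Im (s * Y s) ≥ 0` in the upper half-plane, in denominator-free form. -/
lemma HasAdmittance.exists_im_nonneg {N : RLNetwork} (hN : N.ElementsPositive) {Y : RatFunc ℝ}
    (h : N.HasAdmittance Y) :
    ∃ b J : Polynomial ℝ, b ≠ 0 ∧ algebraMap _ (RatFunc ℝ) J = algebraMap _ (RatFunc ℝ) b * Y ∧
      ∀ s : ℂ, 0 ≤ s.im →
        0 ≤ (s * ((starRingEnd ℂ) (Polynomial.aeval s b) * Polynomial.aeval s J)).im := by
  obtain ⟨b, J, v, i, hb, hJ, h1, h2, h3⟩ :=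
    ((h 1 Y).2 (mul_one Y).symm).exists_polynomial
  refine ⟨b, J, hb, hJ, fun s hs => ?_⟩
  set ev := Polynomial.aeval (R := ℝ) s
  -- Tellegen needs only Kirchhoff's laws, so conjugated potentials may be paired with unconjugated
  -- currents; each element then contributes `conj(Z_e) |i_e|²`.
  have tel := sum_mul_outflow N.tail N.head (fun x => (starRingEnd ℂ) (ev (v x)))
    (fun e => ev (i e))
  have h2' : ∀ x, (∑ e, if N.tail e = x then ev (i e) else 0) -
      (∑ e, if N.head e = x then ev (i e) else 0) =
        if x = N.terminal then ev J else if x = N.terminal' then -ev J else 0 := fun x => by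
    have := congrArg ev (h2 x)
    simpa only [map_sub, map_sum, apply_ite ev, map_zero, map_neg] using this
  have lhs : ∑ x, (starRingEnd ℂ) (ev (v x)) *
      (if x = N.terminal then ev J else if x = N.terminal' then -ev J else 0) =
      (starRingEnd ℂ) (ev b) * ev J := by
    have hne := N.terminal_ne
    have split : ∀ x, (starRingEnd ℂ) (ev (v x)) *
        (if x = N.terminal then ev J else if x = N.terminal' then -ev J else 0) =
        (if x = N.terminal then (starRingEnd ℂ) (ev (v x)) * ev J else 0) -
        (if x = N.terminal' then (starRingEnd ℂ) (ev (v x)) * ev J else 0) := fun x => by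
      by_cases h1 : x = N.terminal
      · subst h1
        simp [hne]
      · by_cases h2 : x = N.terminal'
        · subst h2
          simp [hne.symm]
        · simp [h1, h2]
    simp_rw [split, Finset.sum_sub_distrib, Finset.sum_ite_eq' Finset.univ, Finset.mem_univ,
      if_true, ← h3, map_sub, sub_mul]
  simp_rw [h2'] at tel
  rw [lhs] at tel
  rw [tel, Finset.mul_sum, Complex.im_sum]
  refine Finset.sum_nonneg fun e _ => ?_
  have he : s * (((starRingEnd ℂ) (ev (v (N.tail e))) - (starRingEnd ℂ) (ev (v (N.head e)))) *
      ev (i e)) = s * (starRingEnd ℂ) (ev (N.elt e).polyImpedance) *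
        ((Complex.normSq (ev (i e)) : ℝ) : ℂ) := by
    rw [← map_sub, ← map_sub, h1, map_mul, map_mul, Complex.normSq_eq_conj_mul_self]
    ring
  rw [he, Complex.im_mul_ofReal]
  exact mul_nonneg ((N.elt e).im_mul_conj_polyImpedance_nonneg (hN e) hs) (Complex.normSq_nonneg _)

end RLNetwork

/-! ### Necessity: the sign of the resultant -/

/-- The polynomial `p s² + q s + 1`. -/
noncomputable def quadPoly (p q : ℝ) : Polynomial ℝ :=
  Polynomial.C p * Polynomial.X ^ 2 + Polynomial.C q * Polynomial.X + 1

lemma quadPoly_ne_zero (p q : ℝ) : quadPoly p q ≠ 0 := fun h => by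
  simpa [quadPoly] using congrArg (Polynomial.eval 0) h

lemma aeval_quadPoly (p q : ℝ) (s : ℂ) :
    Polynomial.aeval s (quadPoly p q) = p * s ^ 2 + q * s + 1 := by
  simp [quadPoly]

lemma admittance_eq (a₀ a₁ d₀ d₁ k : ℝ) : admittance a₀ a₁ d₀ d₁ k =
    algebraMap _ (RatFunc ℝ) (Polynomial.C k * quadPoly a₀ a₁) /
      algebraMap _ (RatFunc ℝ) (Polynomial.X * quadPoly d₀ d₁) := by
  simp [admittance, quadPoly]

/-- Cross-multiplied form, valid at every complex point without excluding poles. It serves both the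
network solution and the reduced fraction `num / denom`. -/
lemma poly_mul_eq_of_admittance {a₀ a₁ d₀ d₁ k : ℝ} {b J : Polynomial ℝ}
    (h : algebraMap _ (RatFunc ℝ) J = algebraMap _ (RatFunc ℝ) b * admittance a₀ a₁ d₀ d₁ k) :
    J * (Polynomial.X * quadPoly d₀ d₁) = b * (Polynomial.C k * quadPoly a₀ a₁) := by
  apply RatFunc.algebraMap_injective ℝ
  have hne : algebraMap _ (RatFunc ℝ) (Polynomial.X * quadPoly d₀ d₁) ≠ 0 :=
    RatFunc.algebraMap_ne_zero (mul_ne_zero Polynomial.X_ne_zero (quadPoly_ne_zero _ _))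
  rw [map_mul, map_mul _ b, h, admittance_eq, mul_assoc, div_mul_cancel₀ _ hne]

/-- The factor `s` cancels the pole of `Y` at 0, so this is `Im (s Y)` up to the positive factor `k
/ |d₀s² + d₁s + 1|²`. -/
lemma im_quad_mul_conj (a₀ a₁ d₀ d₁ : ℝ) (s : ℂ) :
    ((a₀ * s ^ 2 + a₁ * s + 1) * (starRingEnd ℂ) (d₀ * s ^ 2 + d₁ * s + 1)).im =
      s.im * ((a₀ * d₁ - a₁ * d₀) * (s.re ^ 2 + s.im ^ 2) + 2 * (a₀ - d₀) * s.re + (a₁ - d₁)) := by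
  simp [pow_two]
  ring

/-- An RL realizable biquadratic admittance has a nonpositive resultant. -/
lemma Rk_nonpos_of_isRLRealizable {a₀ a₁ d₀ d₁ k : ℝ} (hk : 0 < k)
    (h : IsRLRealizable (admittance a₀ a₁ d₀ d₁ k)) : Rk a₀ a₁ d₀ d₁ ≤ 0 := by
  obtain ⟨N, hN, hY⟩ := h
  obtain ⟨b, J, hb, hJ, him⟩ := hY.exists_im_nonneg hN
  have hp := poly_mul_eq_of_admittance hJ
  have key : ∀ s : ℂ, 0 < s.im → Polynomial.aeval s b ≠ 0 →
      0 ≤ (a₀ * d₁ - a₁ * d₀) * (s.re ^ 2 + s.im ^ 2) + 2 * (a₀ - d₀) * s.re + (a₁ - d₁) := by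
    intro s hs hbs
    have e := congrArg (Polynomial.aeval s) hp
    simp only [map_mul, Polynomial.aeval_X, Polynomial.aeval_C, aeval_quadPoly] at e
    have h1 := mul_nonneg (him s hs.le) (Complex.normSq_nonneg (d₀ * s ^ 2 + d₁ * s + 1))
    rw [← Complex.im_mul_ofReal, Complex.normSq_eq_conj_mul_self] at h1
    have e2 : s * ((starRingEnd ℂ) (Polynomial.aeval s b) * Polynomial.aeval s J) *
        ((starRingEnd ℂ) (d₀ * s ^ 2 + d₁ * s + 1) * (d₀ * s ^ 2 + d₁ * s + 1)) =
        (a₀ * s ^ 2 + a₁ * s + 1) * (starRingEnd ℂ) (d₀ * s ^ 2 + d₁ * s + 1) *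
          ((k * Complex.normSq (Polynomial.aeval s b) : ℝ) : ℂ) := by
      rw [Complex.ofReal_mul, Complex.normSq_eq_conj_mul_self]
      simp only [Complex.coe_algebraMap] at e
      linear_combination (starRingEnd ℂ) (Polynomial.aeval s b) *
        (starRingEnd ℂ) (d₀ * s ^ 2 + d₁ * s + 1) * e
    rw [e2, Complex.im_mul_ofReal, im_quad_mul_conj] at h1
    have hpos : 0 < k * Complex.normSq (Polynomial.aeval s b) :=
      mul_pos hk (Complex.normSq_pos.2 hbs)
    exact nonneg_of_mul_nonneg_right (nonneg_of_mul_nonneg_left h1 hpos) hs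
  have hx : ∀ x : ℝ, 0 ≤ (a₀ * d₁ - a₁ * d₀) * (x * x) + 2 * (a₀ - d₀) * x + (a₁ - d₁) := by
    intro x
    -- The real axis is approached along the vertical line `Re s = x`, on which the nonzero
    -- polynomial `b` has finitely many roots.
    have hfin : {y : ℝ | Polynomial.aeval (⟨x, y⟩ : ℂ) b = 0}.Finite := by
      refine ((b.rootSet_finite ℂ).preimage
        (f := fun y : ℝ => (⟨x, y⟩ : ℂ)) ?_).subset fun y hy => ?_
      · intro y _ y' _ h
        exact congrArg Complex.im h
      · exact (Polynomial.mem_rootSet.2 ⟨hb, hy⟩)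
    have hev : ∀ᶠ y in nhdsWithin (0 : ℝ) (Set.Ioi 0), Polynomial.aeval (⟨x, y⟩ : ℂ) b ≠ 0 := by
      -- The point `y = 0` may itself be a root, so it is removed before taking the complement as a
      -- neighbourhood of 0.
      have := (hfin.subset (Set.sdiff_subset (t := {0}))).isClosed.isOpen_compl.mem_nhds
        (x := (0 : ℝ)) (by simp)
      filter_upwards [nhdsWithin_le_nhds this, self_mem_nhdsWithin] with y hy hy0 h0
      exact hy ⟨h0, ne_of_gt hy0⟩
    have hcont : Continuous fun y : ℝ =>
        (a₀ * d₁ - a₁ * d₀) * (x ^ 2 + y ^ 2) + 2 * (a₀ - d₀) * x + (a₁ - d₁) := by fun_prop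
    have := ge_of_tendsto ((hcont.tendsto 0).mono_left nhdsWithin_le_nhds)
      (by filter_upwards [hev, self_mem_nhdsWithin] with y hy hy0 using key ⟨x, y⟩ hy0 hy)
    linarith
  have := discrim_le_zero hx
  unfold discrim at this
  unfold Rk
  linarith

/-! ### Positive-realness, discriminants and interlacing -/

/-- A positive-real biquadratic admittance satisfies `d₁ ≤ a₁`. -/
lemma le_of_isPositiveReal_admittance {a₀ a₁ d₀ d₁ k : ℝ} (hk : 0 < k)
    (hY : IsPositiveReal (admittance a₀ a₁ d₀ d₁ k)) : d₁ ≤ a₁ := by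
  set Y := admittance a₀ a₁ d₀ d₁ k with hYdef
  have hp : Y.num * (Polynomial.X * quadPoly d₀ d₁) =
      Y.denom * (Polynomial.C k * quadPoly a₀ a₁) := by
    apply poly_mul_eq_of_admittance
    rw [← hYdef]
    have hne := RatFunc.algebraMap_ne_zero Y.denom_ne_zero
    exact ((div_eq_iff hne).1 Y.num_div_denom).trans (mul_comm _ _)
  -- `F` is `Re Y` times `|denominator|² / k`: same sign, but continuous up to the imaginary axis.
  -- There it is `y²` times an expression whose limit as `y → 0` is `a₁ - d₁`.
  let F : ℂ → ℝ := fun s =>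
    ((a₀ * s ^ 2 + a₁ * s + 1) * (starRingEnd ℂ) (s * (d₀ * s ^ 2 + d₁ * s + 1))).re
  have hF : ∀ s : ℂ, 0 < s.re → 0 ≤ F s := by
    intro s hs
    obtain ⟨hd, hre⟩ := hY s hs
    have e := congrArg (Polynomial.aeval s) hp
    simp only [map_mul, Polynomial.aeval_X, Polynomial.aeval_C, aeval_quadPoly,
      Complex.coe_algebraMap] at e
    rw [RatFunc.eval] at hre
    change Polynomial.aeval s Y.denom ≠ 0 at hd
    change 0 ≤ (Polynomial.aeval s Y.num / Polynomial.aeval s Y.denom).re at hre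
    set w := Polynomial.aeval s Y.num / Polynomial.aeval s Y.denom with hw
    have e1 : w * (s * (d₀ * s ^ 2 + d₁ * s + 1)) = k * (a₀ * s ^ 2 + a₁ * s + 1) := by
      rw [hw, div_mul_eq_mul_div, e, mul_div_cancel_left₀ _ hd]
    have h1 := mul_nonneg hre (Complex.normSq_nonneg (s * (d₀ * s ^ 2 + d₁ * s + 1)))
    rw [← Complex.re_mul_ofReal, Complex.normSq_eq_conj_mul_self] at h1
    have e2 : w * ((starRingEnd ℂ) (s * (d₀ * s ^ 2 + d₁ * s + 1)) *
        (s * (d₀ * s ^ 2 + d₁ * s + 1))) =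
        ((a₀ * s ^ 2 + a₁ * s + 1) * (starRingEnd ℂ) (s * (d₀ * s ^ 2 + d₁ * s + 1))) * (k : ℂ) := by
      linear_combination (starRingEnd ℂ) (s * (d₀ * s ^ 2 + d₁ * s + 1)) * e1
    rw [e2, Complex.re_mul_ofReal] at h1
    exact nonneg_of_mul_nonneg_left h1 hk
  have hcont : Continuous F := by
    have : Continuous fun s : ℂ =>
        (a₀ * s ^ 2 + a₁ * s + 1) * (starRingEnd ℂ) (s * (d₀ * s ^ 2 + d₁ * s + 1)) :=
      (by fun_prop : Continuous fun s : ℂ => (a₀ * s ^ 2 + a₁ * s + 1 : ℂ)).mul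
        (Complex.continuous_conj.comp (by fun_prop))
    exact Complex.continuous_re.comp this
  have haxis : ∀ y : ℝ, 0 < y → 0 ≤ (a₀ * d₁ - a₁ * d₀) * y ^ 2 + (a₁ - d₁) := by
    intro y hy
    have hc : Continuous fun x : ℝ => F ((x : ℂ) + y * Complex.I) := hcont.comp (by fun_prop)
    have h0 := ge_of_tendsto ((hc.tendsto 0).mono_left nhdsWithin_le_nhds)
      (b := 0) (by
        filter_upwards [self_mem_nhdsWithin (s := Set.Ioi (0 : ℝ))] with x hx
        exact hF _ (by simpa using hx))
    have hval : F (((0 : ℝ) : ℂ) + y * Complex.I) =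
        y ^ 2 * ((a₀ * d₁ - a₁ * d₀) * y ^ 2 + (a₁ - d₁)) := by
      simp [F, pow_two]
      ring
    rw [hval] at h0
    exact nonneg_of_mul_nonneg_right h0 (by positivity)
  have hc : Continuous fun y : ℝ => (a₀ * d₁ - a₁ * d₀) * y ^ 2 + (a₁ - d₁) := by fun_prop
  have := ge_of_tendsto ((hc.tendsto 0).mono_left nhdsWithin_le_nhds)
    (b := 0) (by
      filter_upwards [self_mem_nhdsWithin (s := Set.Ioi (0 : ℝ))] with y hy using haxis y hy)
  linarith

/-- A negative resultant forces both quadratics to have distinct real roots. -/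
lemma discrims_pos_of_Rk_neg {a₀ a₁ d₀ d₁ : ℝ} (h : Rk a₀ a₁ d₀ d₁ < 0) :
    0 < a₁ ^ 2 - 4 * a₀ ∧ 0 < d₁ ^ 2 - 4 * d₀ := by
  have key : 4 * Rk a₀ a₁ d₀ d₁ =
      (2 * (a₀ + d₀) - a₁ * d₁) ^ 2 - (a₁ ^ 2 - 4 * a₀) * (d₁ ^ 2 - 4 * d₀) := by
    unfold Rk; ring
  have hpos : 0 < (a₁ ^ 2 - 4 * a₀) * (d₁ ^ 2 - 4 * d₀) := by
    nlinarith [sq_nonneg (2 * (a₀ + d₀) - a₁ * d₁)]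
  rcases pos_and_pos_or_neg_and_neg_of_mul_pos hpos with h1 | ⟨hu, hw⟩
  · exact h1
  · exfalso
    set u := a₁ ^ 2 - 4 * a₀ with hu'
    set w := d₁ ^ 2 - 4 * d₀ with hw'
    -- The right side equals `((a₁ - d₁)² - (u + w)) / 2`. Squaring, and using `(u + w)² / 4 ≥ u w`,
    -- contradicts `4 R_k < 0` in `key`.
    have hle : -(u + w) / 2 ≤ 2 * (a₀ + d₀) - a₁ * d₁ := by
      nlinarith [sq_nonneg (a₁ - d₁)]
    have hsq := pow_le_pow_left₀ (by linarith : 0 ≤ -(u + w) / 2) hle 2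
    nlinarith [sq_nonneg (u - w)]

/-- With `q(t) = (t - B)(t - D)` the hypothesis is `q(A) q(C) < 0`: exactly one of `A`, `C` lies
strictly between `D` and `B`. If it were `A`, then `C < D` and `A + C < B + D`, against `hsum`. -/
lemma interlacing_of_resultant_neg {A B C D : ℝ} (hAC : C < A) (hBD : D < B)
    (hsum : B + D ≤ A + C) (h : (A - B) * (A - D) * ((C - B) * (C - D)) < 0) :
    B < A ∧ C < B ∧ D < C := by
  have hAB : B < A := by
    by_contra! hle
    have h1 : D < A := by
      by_contra! h1
      have : 0 ≤ (A - B) * (A - D) * ((C - B) * (C - D)) :=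
        mul_nonneg (mul_nonneg_of_nonpos_of_nonpos (by linarith) (by linarith))
          (mul_nonneg_of_nonpos_of_nonpos (by linarith) (by linarith))
      linarith
    have h2 : D ≤ C := by linarith
    have : 0 ≤ (A - B) * (A - D) * ((C - B) * (C - D)) :=
      mul_nonneg_of_nonpos_of_nonpos
        (mul_nonpos_of_nonpos_of_nonneg (by linarith) (by linarith))
        (mul_nonpos_of_nonpos_of_nonneg (by linarith) (by linarith))
    linarith
  have hp : 0 < (A - B) * (A - D) := mul_pos (by linarith) (by linarith)
  have hn : (C - B) * (C - D) < 0 := by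
    by_contra! h0
    linarith [mul_nonneg hp.le h0]
  rcases mul_neg_iff.1 hn with ⟨h1, h2⟩ | ⟨h1, h2⟩
  · linarith
  · exact ⟨hAB, by linarith, by linarith⟩

lemma RatFunc.C_mul_X_add_C_ne_zero (p : ℝ) {q : ℝ} (hq : q ≠ 0) :
    (RatFunc.C p * RatFunc.X + RatFunc.C q : RatFunc ℝ) ≠ 0 := by
  have h : (Polynomial.C p * Polynomial.X + Polynomial.C q : Polynomial ℝ) ≠ 0 := fun h => by
    simpa [hq] using congrArg (Polynomial.eval 0) h
  simpa using RatFunc.algebraMap_ne_zero h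

/-! ### The three-branch network -/

namespace RLNetwork

lemma threeBranch_outflow (L₁ L₂ L₃ R₁ R₂ : ℝ) (i : Fin 5 → RatFunc ℝ) (x : Fin 4) :
    (threeBranch L₁ L₂ L₃ R₁ R₂).outflow i x =
      ![i 0 + i 1 + i 3, -i 0 - i 2 - i 4, i 2 - i 1, i 4 - i 3] x := by
  change (∑ e : Fin 5, if (![0, 0, 2, 0, 3] : Fin 5 → Fin 4) e = x then i e else 0) -
    (∑ e : Fin 5, if (![1, 2, 1, 3, 1] : Fin 5 → Fin 4) e = x then i e else 0) = _
  simp only [Fin.sum_univ_five]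
  fin_cases x <;> simp
  ring

/-- Parallel branch admittances add. Nonzero `L₁`, `R₁`, `R₂` already make the branch impedances
nonzero in `ℝ(X)`; positivity plays no role here. -/
lemma threeBranch_hasAdmittance {L₁ L₂ L₃ R₁ R₂ : ℝ} (hL₁ : L₁ ≠ 0) (hR₁ : R₁ ≠ 0)
    (hR₂ : R₂ ≠ 0) :
    (threeBranch L₁ L₂ L₃ R₁ R₂).HasAdmittance
      (1 / (RatFunc.C L₁ * RatFunc.X) + 1 / (RatFunc.C L₂ * RatFunc.X + RatFunc.C R₁) +
        1 / (RatFunc.C L₃ * RatFunc.X + RatFunc.C R₂)) := by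
  have z1 : (RatFunc.C L₁ * RatFunc.X : RatFunc ℝ) ≠ 0 :=
    mul_ne_zero ((map_ne_zero _).2 hL₁) RatFunc.X_ne_zero
  have z2 := RatFunc.C_mul_X_add_C_ne_zero L₂ hR₁
  have z3 := RatFunc.C_mul_X_add_C_ne_zero L₃ hR₂
  intro V I
  constructor
  · rintro ⟨v, i, h1, h2, h3⟩
    change ∀ e : Fin 5, _ at h1
    change ∀ x : Fin 4, _ at h2
    change Fin 4 → RatFunc ℝ at v
    change Fin 5 → RatFunc ℝ at i
    have e0 : v 0 - v 1 = RatFunc.C L₁ * RatFunc.X * i 0 := h1 0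
    have e1 : v 0 - v 2 = RatFunc.C L₂ * RatFunc.X * i 1 := h1 1
    have e2 : v 2 - v 1 = RatFunc.C R₁ * i 2 := h1 2
    have e3 : v 0 - v 3 = RatFunc.C L₃ * RatFunc.X * i 3 := h1 3
    have e4 : v 3 - v 1 = RatFunc.C R₂ * i 4 := h1 4
    have eV : v 0 - v 1 = V := h3
    have k0 : i 0 + i 1 + i 3 = I := (threeBranch_outflow L₁ L₂ L₃ R₁ R₂ i 0).symm.trans (h2 0)
    have k2 : i 2 - i 1 = 0 := (threeBranch_outflow L₁ L₂ L₃ R₁ R₂ i 2).symm.trans (h2 2)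
    have k3 : i 4 - i 3 = 0 := (threeBranch_outflow L₁ L₂ L₃ R₁ R₂ i 3).symm.trans (h2 3)
    have i0 : i 0 = 1 / (RatFunc.C L₁ * RatFunc.X) * V := by
      rw [one_div_mul_eq_div, eq_div_iff z1]
      linear_combination eV - e0
    have i1 : i 1 = 1 / (RatFunc.C L₂ * RatFunc.X + RatFunc.C R₁) * V := by
      rw [one_div_mul_eq_div, eq_div_iff z2]
      linear_combination eV - e1 - e2 - RatFunc.C R₁ * k2
    have i3 : i 3 = 1 / (RatFunc.C L₃ * RatFunc.X + RatFunc.C R₂) * V := by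
      rw [one_div_mul_eq_div, eq_div_iff z3]
      linear_combination eV - e3 - e4 - RatFunc.C R₂ * k3
    rw [← k0, i0, i1, i3]
    ring
  · rintro rfl
    set j1 := 1 / (RatFunc.C L₁ * RatFunc.X) * V with hj1
    set j2 := 1 / (RatFunc.C L₂ * RatFunc.X + RatFunc.C R₁) * V with hj2
    set j3 := 1 / (RatFunc.C L₃ * RatFunc.X + RatFunc.C R₂) * V with hj3
    have q1 : V = RatFunc.C L₁ * RatFunc.X * j1 := by
      rw [hj1, ← mul_assoc, mul_one_div_cancel z1, one_mul]
    have q2 : V = (RatFunc.C L₂ * RatFunc.X + RatFunc.C R₁) * j2 := by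
      rw [hj2, ← mul_assoc, mul_one_div_cancel z2, one_mul]
    have q3 : V = (RatFunc.C L₃ * RatFunc.X + RatFunc.C R₂) * j3 := by
      rw [hj3, ← mul_assoc, mul_one_div_cancel z3, one_mul]
    -- Terminal `1` is grounded, so each inner node sits at the voltage across its resistor; `j1`,
    -- `j2`, `j3` are the branch currents.
    refine ⟨(![V, 0, RatFunc.C R₁ * j2, RatFunc.C R₂ * j3] : Fin 4 → RatFunc ℝ),
      (![j1, j2, j2, j3, j3] : Fin 5 → RatFunc ℝ), ?_, ?_, ?_⟩
    · change ∀ e : Fin 5, _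
      intro e
      fin_cases e
      · change V - 0 = RatFunc.C L₁ * RatFunc.X * j1
        linear_combination q1
      · change V - RatFunc.C R₁ * j2 = RatFunc.C L₂ * RatFunc.X * j2
        linear_combination q2
      · change RatFunc.C R₁ * j2 - 0 = RatFunc.C R₁ * j2
        ring
      · change V - RatFunc.C R₂ * j3 = RatFunc.C L₃ * RatFunc.X * j3
        linear_combination q3
      · change RatFunc.C R₂ * j3 - 0 = RatFunc.C R₂ * j3
        ring
    · change ∀ x : Fin 4, _
      rw [add_mul, add_mul, ← hj1, ← hj2, ← hj3]
      intro x
      refine (threeBranch_outflow L₁ L₂ L₃ R₁ R₂ _ x).trans ?_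
      fin_cases x
      · change j1 + j2 + j3 = j1 + j2 + j3
        rfl
      · change -j1 - j2 - j3 = -(j1 + j2 + j3)
        ring
      · change j2 - j2 = 0
        ring
      · change j3 - j3 = 0
        ring
    · change V - 0 = V
      ring

end RLNetwork

/-! ### Partial fractions and sufficiency -/

/-- Partial fraction expansion of the factored admittance. -/
lemma partial_fractions {K : Type*} [Field K] (A C k : K) {B D X : K} (hX : X ≠ 0)
    (hBX : B * X + 1 ≠ 0) (hDX : D * X + 1 ≠ 0) (hBD : B - D ≠ 0) :
    1 / (1 / k * X) +
      1 / (B * (B - D) / (k * (A - B) * (B - C)) * X + (B - D) / (k * (A - B) * (B - C))) +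
      1 / (D * (B - D) / (k * (A - D) * (C - D)) * X + (B - D) / (k * (A - D) * (C - D))) =
    k * (A * X + 1) * (C * X + 1) / (X * (B * X + 1) * (D * X + 1)) := by
  have e1 : B * (B - D) / (k * (A - B) * (B - C)) * X + (B - D) / (k * (A - B) * (B - C)) =
      (B - D) * (B * X + 1) / (k * (A - B) * (B - C)) := by ring
  have e2 : D * (B - D) / (k * (A - D) * (C - D)) * X + (B - D) / (k * (A - D) * (C - D)) =
      (B - D) * (D * X + 1) / (k * (A - D) * (C - D)) := by ring
  -- Inverting moves `k(A - B)(B - C)` and `k(A - D)(C - D)` into numerators. Since `0⁻¹ = 0`, this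
  -- is valid even when they vanish, so they need not be assumed nonzero.
  rw [e1, e2, one_div_div, one_div_div, one_div_mul_eq_div, one_div_div]
  rw [div_add_div _ _ hX (mul_ne_zero hBD hBX),
    div_add_div _ _ (mul_ne_zero hX (mul_ne_zero hBD hBX)) (mul_ne_zero hBD hDX),
    div_eq_div_iff (by simp [*]) (by simp [*])]
  ring

/-- The factorization and the three-branch realization for a negative resultant. -/
lemma realization_of_Rk_neg {a₀ a₁ d₀ d₁ k : ℝ} (hd₀ : 0 < d₀) (hd₁ : 0 < d₁)
    (hk : 0 < k) (hle : d₁ ≤ a₁) (hneg : Rk a₀ a₁ d₀ d₁ < 0) {A B C D : ℝ}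
    (hA : A = (a₁ + √(a₁ ^ 2 - 4 * a₀)) / 2) (hC : C = (a₁ - √(a₁ ^ 2 - 4 * a₀)) / 2)
    (hB : B = (d₁ + √(d₁ ^ 2 - 4 * d₀)) / 2) (hD : D = (d₁ - √(d₁ ^ 2 - 4 * d₀)) / 2) :
    0 < a₁ ^ 2 - 4 * a₀ ∧ 0 < d₁ ^ 2 - 4 * d₀ ∧
    A > B ∧ B > C ∧ C > D ∧ D > 0 ∧
    admittance a₀ a₁ d₀ d₁ k =
      RatFunc.C k * (RatFunc.C A * RatFunc.X + 1) * (RatFunc.C C * RatFunc.X + 1) /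
        (RatFunc.X * (RatFunc.C B * RatFunc.X + 1) * (RatFunc.C D * RatFunc.X + 1)) ∧
    ∀ L₁ L₂ L₃ R₁ R₂ : ℝ,
      L₁ = 1 / k →
      L₂ = B * (B - D) / (k * (A - B) * (B - C)) →
      L₃ = D * (B - D) / (k * (A - D) * (C - D)) →
      R₁ = (B - D) / (k * (A - B) * (B - C)) →
      R₂ = (B - D) / (k * (A - D) * (C - D)) →
      (RLNetwork.threeBranch L₁ L₂ L₃ R₁ R₂).ElementsPositive ∧
      (RLNetwork.threeBranch L₁ L₂ L₃ R₁ R₂).HasAdmittance (admittance a₀ a₁ d₀ d₁ k) := by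
  obtain ⟨hda, hdd⟩ := discrims_pos_of_Rk_neg hneg
  have sa := Real.sq_sqrt hda.le
  have sd := Real.sq_sqrt hdd.le
  have pa := Real.sqrt_pos.2 hda
  have pd := Real.sqrt_pos.2 hdd
  have a1 : a₁ = A + C := by rw [hA, hC]; ring
  have a0 : a₀ = A * C := by rw [hA, hC]; linear_combination sa / 4
  have d1 : d₁ = B + D := by rw [hB, hD]; ring
  have d0 : d₀ = B * D := by rw [hB, hD]; linear_combination sd / 4
  have hAC : C < A := by linarith
  have hBD : D < B := by linarith
  clear hA hB hC hD sa sd pa pd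
  -- `A`, `C` and `B`, `D` are the negative reciprocals of the zeros and of the nonzero poles; in
  -- them `R_k` is the product of all differences, and `hle` reads `B + D ≤ A + C`.
  obtain ⟨hAB, hBC, hCD⟩ := interlacing_of_resultant_neg hAC hBD (by linarith) (by
    have : Rk a₀ a₁ d₀ d₁ = (A - B) * (A - D) * ((C - B) * (C - D)) := by
      rw [a0, a1, d0, d1, Rk]; ring
    linarith)
  have hBpos : 0 < B := by linarith
  have hDpos : 0 < D := by
    rw [d0] at hd₀
    exact pos_of_mul_pos_right hd₀ hBpos.le
  have hfac : admittance a₀ a₁ d₀ d₁ k =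
      RatFunc.C k * (RatFunc.C A * RatFunc.X + 1) * (RatFunc.C C * RatFunc.X + 1) /
        (RatFunc.X * (RatFunc.C B * RatFunc.X + 1) * (RatFunc.C D * RatFunc.X + 1)) := by
    rw [admittance, a0, a1, d0, d1]
    simp only [map_mul, map_add]
    congr 1 <;> ring
  refine ⟨hda, hdd, hAB, hBC, hCD, hDpos, hfac, ?_⟩
  intro L₁ L₂ L₃ R₁ R₂ hL₁ hL₂ hL₃ hR₁ hR₂
  have pAB := sub_pos.2 hAB
  have pBC := sub_pos.2 hBC
  have pCD := sub_pos.2 hCD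
  have pBD := sub_pos.2 hBD
  have pAD : 0 < A - D := by linarith
  have l1 : 0 < L₁ := by rw [hL₁]; positivity
  have l2 : 0 < L₂ := by rw [hL₂]; positivity
  have l3 : 0 < L₃ := by rw [hL₃]; positivity
  have r1 : 0 < R₁ := by rw [hR₁]; positivity
  have r2 : 0 < R₂ := by rw [hR₂]; positivity
  constructor
  · change ∀ e : Fin 5, _
    intro e
    fin_cases e
    exacts [l1, l2, r1, l3, r2]
  · have hsum := RLNetwork.threeBranch_hasAdmittance (L₂ := L₂) (L₃ := L₃) l1.ne' r1.ne' r2.ne'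
    have cne : ∀ {x : ℝ}, 0 < x → (RatFunc.C x : RatFunc ℝ) ≠ 0 :=
      fun hx => (map_ne_zero _).2 hx.ne'
    convert hsum using 1
    rw [hfac, hL₁, hL₂, hL₃, hR₁, hR₂]
    have hBX := RatFunc.C_mul_X_add_C_ne_zero B one_ne_zero
    have hDX := RatFunc.C_mul_X_add_C_ne_zero D one_ne_zero
    rw [map_one] at hBX hDX
    have := partial_fractions (K := RatFunc ℝ) (RatFunc.C A) (RatFunc.C C) (RatFunc.C k)
      RatFunc.X_ne_zero hBX hDX (by simpa using cne pBD)
    rw [← this]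
    simp only [map_div₀, map_mul, map_sub, map_one]

theorem theorem5 (a₀ a₁ d₀ d₁ k : ℝ) (ha₀ : 0 < a₀) (ha₁ : 0 < a₁) (hd₀ : 0 < d₀) (hd₁ : 0 < d₁)
    (hk : 0 < k) (hY : IsPositiveReal (admittance a₀ a₁ d₀ d₁ k)) (hR : Rk a₀ a₁ d₀ d₁ ≠ 0) :
    (IsRLRealizable (admittance a₀ a₁ d₀ d₁ k) ↔ Rk a₀ a₁ d₀ d₁ < 0) ∧
    (Rk a₀ a₁ d₀ d₁ < 0 →
      ∀ A B C D : ℝ,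
        A = (a₁ + √(a₁ ^ 2 - 4 * a₀)) / 2 → C = (a₁ - √(a₁ ^ 2 - 4 * a₀)) / 2 →
        B = (d₁ + √(d₁ ^ 2 - 4 * d₀)) / 2 → D = (d₁ - √(d₁ ^ 2 - 4 * d₀)) / 2 →
        0 < a₁ ^ 2 - 4 * a₀ ∧ 0 < d₁ ^ 2 - 4 * d₀ ∧
        A > B ∧ B > C ∧ C > D ∧ D > 0 ∧
        admittance a₀ a₁ d₀ d₁ k =
          RatFunc.C k * (RatFunc.C A * RatFunc.X + 1) * (RatFunc.C C * RatFunc.X + 1) /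
            (RatFunc.X * (RatFunc.C B * RatFunc.X + 1) * (RatFunc.C D * RatFunc.X + 1)) ∧
        ∀ L₁ L₂ L₃ R₁ R₂ : ℝ,
          L₁ = 1 / k →
          L₂ = B * (B - D) / (k * (A - B) * (B - C)) →
          L₃ = D * (B - D) / (k * (A - D) * (C - D)) →
          R₁ = (B - D) / (k * (A - B) * (B - C)) →
          R₂ = (B - D) / (k * (A - D) * (C - D)) →
          (RLNetwork.threeBranch L₁ L₂ L₃ R₁ R₂).ElementsPositive ∧
          (RLNetwork.threeBranch L₁ L₂ L₃ R₁ R₂).HasAdmittance (admittance a₀ a₁ d₀ d₁ k)) := by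
  have hle := le_of_isPositiveReal_admittance hk hY
  refine ⟨⟨fun h => lt_of_le_of_ne (Rk_nonpos_of_isRLRealizable hk h) hR, fun hneg => ?_⟩,
    fun hneg A B C D hA hC hB hD => realization_of_Rk_neg hd₀ hd₁ hk hle hneg hA hC hB hD⟩
  obtain ⟨-, -, -, -, -, -, -, h⟩ := realization_of_Rk_neg hd₀ hd₁ hk hle hneg rfl rfl rfl rfl
  exact ⟨_, h _ _ _ _ _ rfl rfl rfl rfl rfl⟩
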